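/- **Setting.** Let $N,p,B\ge 1$ be integers, $a\in(0,1)$ and $F,G,R>0$. $\|\cdot\|$ is the Euclidean norm and $[\cdot]_+$ the componentwise projection onto $\mathbb{R}^p_+$. *Network.* For every $t\ge1$ let $\mathcal G_t=(\{1,\dots,N\},\mathcal E_t)$ be a directed graph, $\mathcal N_{i,t}=\{j:(j,i)\in\mathcal E_t\}\cup\{i\}$, and let $W_t=(w_{ij,t})$ be a real matrix with $w_{ij,t}>0$ if $j\in\mathcal N_{i,t}$ and $w_{ij,t}=0$ otherwise. Assume that (i) every positive $w_{ij,t}$ is larger than $a$; (ii) $\sum_{i=1}^N w_{ij,t}=1$ for all $j$ and $t$; (iii) for every $k\ge 0$ the directed graph with edge set $\bigcup_{t=kB+1}^{(k+1)B}\mathcal E_t$ is strongly connected. *Problem.* For each $i$ let $X_i\subseteq\mathbb R^{d_i}$ be compact and convex with diameter at most $R$, let $g_i:\mathbb R^{d_i}\to\mathbb R^p$ have components convex on $X_i$, and for $t\ge 1$ let $f_{i,t}:\mathbb R^{d_i}\to\mathbb R$ be convex on $X_i$. Assume that there is $(x_i)_i\in\prod_i X_i$ with $\sum_{i} g_i(x_i)\le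 0$. For $x\in X_i$ let $\partial f_{i,t}(x)$ denote a chosen subgradient, i.e. a vector with $f_{i,t}(y)\ge f_{i,t}(x)+\langle\partial f_{i,t}(x),y-x\rangle$ for all $y\in X_i$, and assume that $\|g_i(x)\|\le F$ and $\|\partial f_{i,t}(x)\|\le G$ for all $i$, all $t\ge1$ and all $x\in X_i$. *Algorithm (DUST).* Let $\alpha_t=\sqrt t$ and $\eta_t=t$. Start with arbitrary $x_{i,1}\in X_i$, $c_{i,1}=1$, $\mu_{i,1}=0$, $y_{i,1}=g_i(x_{i,1})$, and for $t\ge1$ and all $i$ set $$c_{i,t+1}=\sum_{j\in\mathcal N_{i,t}}w_{ij,t}c_{j,t},\qquad \lambda_{i,t+1}=\frac{1}{c_{i,t+1}}\sum_{j\in\mathcal N_{i,t}}w_{ij,t}\mu_{j,t},$$ $$x_{i,t+1}\in\operatorname*{arg\,min}_{x\in X_i}\Big\{\alpha_t\langle\partial f_{i,t}(x_{i,t}),x-x_{i,t}\rangle+\langle\lambda_{i,t+1},g_i(x)\rangle+\eta_t\|x-x_{i,t}\|^2\Big\},$$ $$y_{i,t+1}=\sum_{j\in\mathcal N_{i,t}}w_{ij,t}y_{j,t}+g_i(x_{i,t+1})-g_i(x_{i,t}),\qquad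 \mu_{i,t+1}=\Big[\sum_{j\in\mathcal N_{i,t}}w_{ij,t}\mu_{j,t}+y_{i,t+1}\Big]_+ .$$ **Theorem.** Without any Slater condition, the cumulative violation of the coupled constraint satisfies $\operatorname{Reg}^c(T)=\mathcal O(T^{3/4})$; precisely, there is a constant $C$ depending only on $N,p,B,a,F,G,R$ such that for every such network, problem and run of the algorithm, and for every $T\ge1$, $$\operatorname{Reg}^c(T):=\Big\|\Big[\sum_{t=1}^T\sum_{i=1}^N g_i(x_{i,t})\Big]_+\Big\|\le C\,T^{3/4}.$$ -/

import Mathlib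

noncomputable section

/-- Euclidean space `ℝⁿ`. -/
abbrev Eucl (n : ℕ) : Type := EuclideanSpace ℝ (Fin n)

/-- Componentwise projection `[v]₊` of a vector onto the nonnegative orthant. -/
def nonnegProj {p : ℕ} (v : Eucl p) : Eucl p :=
  WithLp.toLp 2 (fun k => max (v k) 0)

/-! ### The time-varying directed network -/

/-- A sequence of directed graphs on `N` nodes together with a sequence of weight matrices.
`(graph t).Adj j i` means that at time `t` node `i` can receive a message from node `j`.
Times are `t ≥ 1`; the values at index `0` are never used. -/
structure Network (N : ℕ) where
  graph : ℕ → Digraph (Fin N)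
  W : ℕ → Matrix (Fin N) (Fin N) ℝ

namespace Network

variable {N : ℕ}

open Classical in
/-- The in-neighbours of node `i` at time `t`, the node `i` itself included. -/
def inNeighbors (net : Network N) (t : ℕ) (i : Fin N) : Finset (Fin N) :=
  Finset.univ.filter (fun j => (net.graph t).Adj j i ∨ j = i)

/-- The standing assumption on the network, with weight bound `a` and connectivity window `B`. -/
structure Admissible (net : Network N) (a : ℝ) (B : ℕ) : Prop where
  /-- `w_{ij,t} > 0` if `(j,i)` is an edge at time `t` or `i = j` -/
  weight_pos : ∀ t, 1 ≤ t → ∀ i j, j ∈ net.inNeighbors t i → 0 < net.W t i j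
  /-- `w_{ij,t} = 0` otherwise -/
  weight_zero : ∀ t, 1 ≤ t → ∀ i j, j ∉ net.inNeighbors t i → net.W t i j = 0
  /-- positive weights exceed `a` -/
  weight_lower : ∀ t, 1 ≤ t → ∀ i j, 0 < net.W t i j → a < net.W t i j
  /-- the mixing matrices are column stochastic -/
  column_stochastic : ∀ t, 1 ≤ t → ∀ j, ∑ i, net.W t i j = 1
  /-- the union of the graphs over `kB+1, …, (k+1)B` is (strongly) connected: there is a directed
  path from every node to every other node -/
  connected : ∀ k : ℕ, ∀ i j : Fin N,
    Relation.ReflTransGen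
      (fun u v => ∃ t ∈ Finset.Icc (k * B + 1) ((k + 1) * B), (net.graph t).Adj u v) i j

end Network

/-! ### The online problem with a coupled inequality constraint -/

/-- The data of the online problem: constraint sets `X_i`, local costs `f_{i,t}` (used for `t ≥ 1`)
and local constraint functions `g_i` with values in `ℝᵖ`. -/
structure OnlineProblem (N p : ℕ) (d : Fin N → ℕ) where
  X : ∀ i, Set (Eucl (d i))
  f : ∀ i, ℕ → Eucl (d i) → ℝ
  g : ∀ i, Eucl (d i) → Eucl p

namespace OnlineProblem

variable {N p : ℕ} {d : Fin N → ℕ}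

/-- The feasible set `{x ∈ ∏ X_i : ∑ g_i(x_i) ≤ 0}`, the inequality being componentwise. -/
def feasibleSet (P : OnlineProblem N p d) : Set (∀ i, Eucl (d i)) :=
  {x | (∀ i, x i ∈ P.X i) ∧ ∀ k : Fin p, (∑ i, P.g i (x i)) k ≤ 0}

/-- The standing assumption on the problem: the `X_i` are compact and convex with diameter at most
`R`, and `f_{i,t}` and (the components of) `g_i` are convex on `X_i`. -/
structure Admissible (P : OnlineProblem N p d) (R : ℝ) : Prop where
  compact : ∀ i, IsCompact (P.X i)
  convex : ∀ i, Convex ℝ (P.X i)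
  diam_le : ∀ i, Metric.diam (P.X i) ≤ R
  convex_f : ∀ i t, 1 ≤ t → ConvexOn ℝ (P.X i) (P.f i t)
  convex_g : ∀ i (k : Fin p), ConvexOn ℝ (P.X i) (fun x => P.g i x k)

/-- `sub i t x` is, for all `x ∈ X_i` and `t ≥ 1`, a subgradient of `f_{i,t}` at `x` (with respect
to `X_i`): this is the choice of `∂f_{i,t}(x)`. -/
def IsSubgradientSelection (P : OnlineProblem N p d)
    (sub : ∀ i, ℕ → Eucl (d i) → Eucl (d i)) : Prop :=
  ∀ i t, 1 ≤ t → ∀ x ∈ P.X i, ∀ y ∈ P.X i,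
    P.f i t x + inner ℝ (sub i t x) (y - x) ≤ P.f i t y

/-- `‖g_i(x)‖ ≤ F` and `‖∂f_{i,t}(x)‖ ≤ G` for all `i`, all `t ≥ 1` and all `x ∈ X_i`. -/
structure Bounded (P : OnlineProblem N p d)
    (sub : ∀ i, ℕ → Eucl (d i) → Eucl (d i)) (F G : ℝ) : Prop where
  norm_g_le : ∀ i, ∀ x ∈ P.X i, ‖P.g i x‖ ≤ F
  norm_sub_le : ∀ i t, 1 ≤ t → ∀ x ∈ P.X i, ‖sub i t x‖ ≤ G

/-- The cumulative constraint violation `Reg^c(T) = ‖[∑_{t=1}^T ∑_i g_i(x_{i,t})]₊‖`. -/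
def cumulativeViolation (P : OnlineProblem N p d) (x : ∀ i, ℕ → Eucl (d i)) (T : ℕ) : ℝ :=
  ‖nonnegProj (∑ t ∈ Finset.Icc 1 T, ∑ i, P.g i (x i t))‖

end OnlineProblem

/-! ### The distributed dual subgradient tracking algorithm -/

/-- The sequences generated by the algorithm (used for `t ≥ 1`). -/
structure DUSTIterates (N p : ℕ) (d : Fin N → ℕ) where
  c : Fin N → ℕ → ℝ
  lam : Fin N → ℕ → Eucl p
  x : ∀ i, ℕ → Eucl (d i)
  y : Fin N → ℕ → Eucl p
  mu : Fin N → ℕ → Eucl p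

/-- `it` is a run of the algorithm on the problem `P` over the network `net`, with subgradient
choice `sub` and step sizes `α`, `η`. The initial points `x_{i,1} ∈ X_i` are arbitrary. -/
structure IsDUSTRun {N p : ℕ} {d : Fin N → ℕ} (net : Network N) (P : OnlineProblem N p d)
    (sub : ∀ i, ℕ → Eucl (d i) → Eucl (d i)) (α η : ℕ → ℝ) (it : DUSTIterates N p d) : Prop where
  x_one : ∀ i, it.x i 1 ∈ P.X i
  c_one : ∀ i, it.c i 1 = 1
  mu_one : ∀ i, it.mu i 1 = 0
  y_one : ∀ i, it.y i 1 = P.g i (it.x i 1)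
  c_succ : ∀ t, 1 ≤ t → ∀ i,
    it.c i (t + 1) = ∑ j ∈ net.inNeighbors t i, net.W t i j * it.c j t
  lam_succ : ∀ t, 1 ≤ t → ∀ i,
    it.lam i (t + 1) = (it.c i (t + 1))⁻¹ • ∑ j ∈ net.inNeighbors t i, net.W t i j • it.mu j t
  x_succ_mem : ∀ t, 1 ≤ t → ∀ i, it.x i (t + 1) ∈ P.X i
  x_succ_isMinOn : ∀ t, 1 ≤ t → ∀ i,
    IsMinOn
      (fun z => α t * inner ℝ (sub i t (it.x i t)) (z - it.x i t)
        + inner ℝ (it.lam i (t + 1)) (P.g i z) + η t * ‖z - it.x i t‖ ^ 2)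
      (P.X i) (it.x i (t + 1))
  y_succ : ∀ t, 1 ≤ t → ∀ i,
    it.y i (t + 1) = ∑ j ∈ net.inNeighbors t i, net.W t i j • it.y j t
      + P.g i (it.x i (t + 1)) - P.g i (it.x i t)
  mu_succ : ∀ t, 1 ≤ t → ∀ i,
    it.mu i (t + 1) =
      nonnegProj (∑ j ∈ net.inNeighbors t i, net.W t i j • it.mu j t + it.y i (t + 1))

end

/-!
The multipliers control the violation: since `[v]₊ ≥ v`, the mixing is column stochastic and the
trackers satisfy `∑ᵢ y_{i,t} = ∑ᵢ g_i(x_{i,t})`, the sum `∑ᵢ μ_{i,T}` dominates the accumulated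
constraint values up to the one at `t = 1`. So it suffices that the dual energy
`V_t = ∑ᵢ ‖μ_{i,t}‖² / c_{i,t}`, which satisfies `‖∑ᵢ μ_{i,t}‖² ≤ N V_t`, grows at most like
`t ^ (3 / 2)`.

Mixing does not increase `V` (Cauchy–Schwarz), and the projection does not either, whence
`V_{t+1} ≤ V_t + 2 ∑ᵢ ⟨λ_{i,t+1}, y_{i,t+1}⟩ + ∑ᵢ ‖y_{i,t+1}‖² / c_{i,t+1}`.
If the `y_{i,t}` are bounded and the `λ_{i,t}` of different nodes are a bounded distance apart, then
the cross term is, up to a constant, `∑ᵢ ⟨λ_{i,t+1}, g_i(x_{i,t+1})⟩`. The three-point inequality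
for the primal step, applied at a feasible point `z`, bounds this by a constant plus
`N √t G R + t (r_t - r_{t+1})` with `r_t = ∑ᵢ ‖z_i - x_{i,t}‖²`. Hence the potential `V_t + 2 t r_t`
increases by `O(√t)` per step. No Slater point is needed: feasibility of `z` suffices, because the
multipliers are nonnegative.

The two boundedness claims are consensus statements (`IsDUSTRun.norm_y_le`,
`IsDUSTRun.norm_lam_sub_le`). The masses `c_{i,t}` are bounded below, so `y_{i,t} / c_{i,t}` and
`μ_{i,t} / c_{i,t}` follow row-stochastic averagings with bounded perturbations and with weights
bounded below along the edges. The spread of such a recursion contracts by a fixed factor over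
`N + 2` connectivity windows (`Network.IsAveraging.window`) and therefore stays bounded.
-/

/-! ### Propagation and averaging over the network -/

namespace Network

variable {N : ℕ} {net : Network N} {a : ℝ} {B : ℕ}

lemma self_mem_inNeighbors (net : Network N) (t : ℕ) (i : Fin N) : i ∈ net.inNeighbors t i := by
  simp [inNeighbors]

lemma mem_inNeighbors_of_adj {t : ℕ} {i j : Fin N} (h : (net.graph t).Adj j i) :
    j ∈ net.inNeighbors t i := by
  simp [inNeighbors, h]

lemma Admissible.weight_nonneg (h : net.Admissible a B) {t : ℕ} (ht : 1 ≤ t) (i j : Fin N) :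
    0 ≤ net.W t i j := by
  by_cases hj : j ∈ net.inNeighbors t i
  · exact (h.weight_pos t ht i j hj).le
  · exact (h.weight_zero t ht i j hj).ge

lemma Admissible.weight_ge (h : net.Admissible a B) {t : ℕ} (ht : 1 ≤ t) {i j : Fin N}
    (hj : j ∈ net.inNeighbors t i) : a ≤ net.W t i j :=
  (h.weight_lower t ht i j (h.weight_pos t ht i j hj)).le

lemma Admissible.sum_inNeighbors_smul {E : Type*} [AddCommGroup E] [Module ℝ E]
    (h : net.Admissible a B) {t : ℕ} (ht : 1 ≤ t) (i : Fin N) (v : Fin N → E) :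
    ∑ j ∈ net.inNeighbors t i, net.W t i j • v j = ∑ j, net.W t i j • v j := by
  refine Finset.sum_subset (Finset.subset_univ _) fun j _ hj => ?_
  rw [h.weight_zero t ht i j hj, zero_smul]

/-- Column stochasticity: mixing preserves the sum over the nodes. -/
lemma Admissible.sum_sum_smul {E : Type*} [AddCommGroup E] [Module ℝ E]
    (h : net.Admissible a B) {t : ℕ} (ht : 1 ≤ t) (v : Fin N → E) :
    ∑ i, ∑ j, net.W t i j • v j = ∑ j, v j := by
  rw [Finset.sum_comm]
  refine Finset.sum_congr rfl fun j _ => ?_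
  rw [← Finset.sum_smul, h.column_stochastic t ht j, one_smul]

/-- A property of nodes that is passed on along the edges (self-loops included) and holds at one
node at time `s` holds at every node at time `s + (N + 2) B`: in every connectivity window that
does not start with the property at all nodes, at least one more node acquires it. -/
theorem Admissible.forall_of_propagates (h : net.Admissible a B) (hB : 0 < B)
    {Q : ℕ → Fin N → Prop} {s : ℕ} {j₀ : Fin N} (hj₀ : Q s j₀)
    (hQ : ∀ t, s ≤ t → ∀ i, ∀ j ∈ net.inNeighbors t i, Q t j → Q (t + 1) i) (i : Fin N) :
    Q (s + (N + 2) * B) i := by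
  classical
  have mono : ∀ t, s ≤ t → ∀ t', t ≤ t' → ∀ i, Q t i → Q t' i := by
    intro t ht t' htt' i hi
    induction t', htt' using Nat.le_induction with
    | base => exact hi
    | succ n hn ih => exact hQ n (ht.trans hn) i i (net.self_mem_inNeighbors n i) ih
  obtain ⟨k, hk₁, hk₂⟩ : ∃ k, s ≤ k * B ∧ k * B ≤ s + B := by
    refine ⟨s / B + 1, ?_, ?_⟩
    · have := Nat.div_add_mod s B
      have := Nat.mod_lt s hB
      nlinarith
    · have := Nat.div_mul_le_self s B
      nlinarith
  have key : ∀ m : ℕ, m + 1 ≤ (Finset.univ.filter (Q ((k + m) * B + 1))).card ∨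
      ∀ i, Q ((k + m) * B + 1) i := by
    intro m
    induction m with
    | zero =>
      left
      refine Finset.card_pos.2 ⟨j₀, ?_⟩
      simpa using mono s le_rfl (k * B + 1) (by omega) j₀ hj₀
    | succ m ih =>
      have hs : s ≤ (k + m) * B + 1 := by nlinarith
      have hle : (k + m) * B + 1 ≤ (k + (m + 1)) * B + 1 := by nlinarith
      by_cases hall : ∀ i, Q ((k + m) * B + 1) i
      · exact Or.inr fun i => mono _ hs _ hle i (hall i)
      left
      have hcard := ih.resolve_right hall
      push Not at hall
      obtain ⟨i₁, hi₁⟩ := hall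
      -- a path from a node with the property to one without it leaves the set along some edge
      have hedge : ∃ u v, Q ((k + m) * B + 1) u ∧ ¬ Q ((k + m) * B + 1) v ∧
          ∃ t ∈ Finset.Icc ((k + m) * B + 1) ((k + m + 1) * B), (net.graph t).Adj u v := by
        by_contra hno
        push Not at hno
        have hpath := h.connected (k + m) j₀ i₁
        refine hi₁ ?_
        induction hpath with
        | refl => exact mono s le_rfl _ hs j₀ hj₀
        | tail _ he ih' =>
          rename_i u v _
          obtain ⟨t, ht, hadj⟩ := he
          by_contra hv
          by_cases hu : Q ((k + m) * B + 1) u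
          · exact hno u v hu hv t ht hadj
          · exact hu (ih' hu)
      obtain ⟨u, v, hu, hv, t, ht, hadj⟩ := hedge
      rw [Finset.mem_Icc] at ht
      have hv' : Q ((k + (m + 1)) * B + 1) v :=
        mono (t + 1) (by omega) _ (by have := ht.2; rw [add_assoc] at this; omega) v
          (hQ t (by omega) v u (mem_inNeighbors_of_adj hadj) (mono _ hs t ht.1 u hu))
      refine (Nat.succ_le_succ hcard).trans (Finset.card_lt_card ?_)
      rw [Finset.ssubset_iff_of_subset]
      · exact ⟨v, by simpa using hv', by simpa using hv⟩
      · intro w hw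
        simp only [Finset.mem_filter, Finset.mem_univ, true_and] at hw ⊢
        exact mono _ hs _ hle w hw
  rcases key N with hN | hN
  · have := (Finset.univ.filter (Q ((k + N) * B + 1))).card_le_univ
    rw [Fintype.card_fin] at this
    omega
  · exact mono _ (by nlinarith) _ (by nlinarith) i (hN i)

lemma Admissible.sum_mass (h : net.Admissible a B) {c : Fin N → ℕ → ℝ} (h₁ : ∀ i, c i 1 = 1)
    (hc : ∀ t, 1 ≤ t → ∀ i, c i (t + 1) = ∑ j, net.W t i j * c j t) {t : ℕ} (ht : 1 ≤ t) :
    ∑ i, c i t = N := by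
  induction t, ht using Nat.le_induction with
  | base => simp [h₁]
  | succ n hn ih =>
    rw [Finset.sum_congr rfl fun i _ => hc n hn i]
    exact (h.sum_sum_smul hn fun j => c j n).trans ih

/-- The masses `c_{i,t}` stay above `a ^ ((N + 2) B)`. -/
theorem Admissible.mass_ge (h : net.Admissible a B) (hB : 0 < B) (ha : 0 < a) (ha' : a < 1)
    {c : Fin N → ℕ → ℝ} (h₁ : ∀ i, c i 1 = 1)
    (hc : ∀ t, 1 ≤ t → ∀ i, c i (t + 1) = ∑ j, net.W t i j * c j t)
    {t : ℕ} (ht : 1 ≤ t) (i : Fin N) : a ^ ((N + 2) * B) ≤ c i t := by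
  have hpos : ∀ t, 1 ≤ t → ∀ i, 0 ≤ c i t := by
    intro t ht
    induction t, ht using Nat.le_induction with
    | base => intro i; simp [h₁]
    | succ n hn ih =>
      intro i
      rw [hc n hn i]
      exact Finset.sum_nonneg fun j _ => mul_nonneg (h.weight_nonneg hn i j) (ih j)
  have step : ∀ t, 1 ≤ t → ∀ i, ∀ j ∈ net.inNeighbors t i, a * c j t ≤ c i (t + 1) := by
    intro t ht i j hj
    rw [hc t ht i]
    refine (mul_le_mul_of_nonneg_right (h.weight_ge ht hj) (hpos t ht j)).trans ?_
    exact Finset.single_le_sum (f := fun j => net.W t i j * c j t)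
      (fun j _ => mul_nonneg (h.weight_nonneg ht i j) (hpos t ht j)) (Finset.mem_univ j)
  have prop : ∀ s, 1 ≤ s → ∀ t, s ≤ t → ∀ i, ∀ j ∈ net.inNeighbors t i,
      a ^ (t - s) ≤ c j t → a ^ (t + 1 - s) ≤ c i (t + 1) := by
    intro s hs t hst i j hj hle
    rw [Nat.sub_add_comm hst, pow_succ']
    exact (mul_le_mul_of_nonneg_left hle ha.le).trans (step t (hs.trans hst) i j hj)
  rcases le_or_gt t ((N + 2) * B) with hle | hgt
  · have hself : a ^ (t - 1) ≤ c i t := by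
      clear hle
      induction t, ht using Nat.le_induction with
      | base => simp [h₁]
      | succ n hn ih => exact prop 1 le_rfl n hn i i (net.self_mem_inNeighbors n i) ih
    exact (pow_le_pow_of_le_one ha.le ha'.le (by omega)).trans hself
  · obtain ⟨s, rfl⟩ : ∃ s, t = s + (N + 2) * B := ⟨t - (N + 2) * B, by omega⟩
    have hs : 1 ≤ s := by omega
    -- the average mass is `1`, so some node starts the window with mass at least `1`
    obtain ⟨j₀, hj₀⟩ : ∃ j, 1 ≤ c j s := by
      by_contra hno
      push Not at hno
      have := Finset.sum_lt_sum_of_nonempty ⟨i, Finset.mem_univ i⟩ (fun j _ => hno j)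
      rw [h.sum_mass h₁ hc hs] at this
      simp at this
    have := h.forall_of_propagates hB (Q := fun t i => a ^ (t - s) ≤ c i t) (s := s)
      (j₀ := j₀) (by simpa using hj₀) (prop s hs) i
    simpa using this

/-- Row-stochastic matrices `A_t`, `t ≥ 1`, whose entries are at least `b` along the edges of the
network and on the diagonal. -/
structure IsAveraging (net : Network N) (b : ℝ) (A : ℕ → Matrix (Fin N) (Fin N) ℝ) : Prop where
  nonneg : ∀ t, 1 ≤ t → ∀ i j, 0 ≤ A t i j
  row_sum : ∀ t, 1 ≤ t → ∀ i, ∑ j, A t i j = 1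
  lower : ∀ t, 1 ≤ t → ∀ i, ∀ j ∈ net.inNeighbors t i, b ≤ A t i j

/-- A bound for the spread of a perturbed averaging recursion, relative to the size `E` of the
perturbations, where a window of length `L` contracts by `1 - b ^ L`: the first summand is the
fixed point of `D ↦ (1 - b ^ L) D + 2 L`, the second accounts for the times before the first window
is complete. -/
noncomputable def spreadConst (b : ℝ) (L : ℕ) : ℝ := 2 * L / b ^ L + 2 * (L + 1)

/-- Over `n` steps of a perturbed averaging recursion the maximum grows by at most `n E`. -/
lemma IsAveraging.le_add {b : ℝ} {A : ℕ → Matrix (Fin N) (Fin N) ℝ} (hA : net.IsAveraging b A)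
    {u : Fin N → ℕ → ℝ} {E : ℝ}
    (hu : ∀ t, 1 ≤ t → ∀ i, |u i (t + 1) - ∑ j, A t i j * u j t| ≤ E)
    {s : ℕ} (hs : 1 ≤ s) {M : ℝ} (hM : ∀ i, u i s ≤ M) (n : ℕ) (i : Fin N) :
    u i (s + n) ≤ M + n * E := by
  induction n generalizing i with
  | zero => simpa using hM i
  | succ n ih =>
    have h1 := (abs_le.1 (hu (s + n) (by omega) i)).2
    have h2 : ∑ j, A (s + n) i j * u j (s + n) ≤ ∑ j, A (s + n) i j * (M + n * E) :=
      Finset.sum_le_sum fun j _ =>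
        mul_le_mul_of_nonneg_left (ih j) (hA.nonneg _ (by omega) i j)
    rw [← Finset.sum_mul, hA.row_sum _ (by omega) i, one_mul] at h2
    rw [← add_assoc]
    push_cast
    linarith

/-- Over one window of length `(N + 2) B` the spread `M - m` contracts by the factor
`1 - b ^ ((N + 2) B)`, up to the accumulated perturbations: the deficit `M - m` of the node that
attains the minimum reaches every other node, losing a factor `b` at each step. -/
lemma IsAveraging.window {b : ℝ} {A : ℕ → Matrix (Fin N) (Fin N) ℝ} (hA : net.IsAveraging b A)
    (h : net.Admissible a B) (hB : 0 < B) (hb : 0 < b) {u : Fin N → ℕ → ℝ} {E : ℝ}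
    (hu : ∀ t, 1 ≤ t → ∀ i, |u i (t + 1) - ∑ j, A t i j * u j t| ≤ E)
    {s : ℕ} (hs : 1 ≤ s) {j₀ : Fin N} {M : ℝ} (hM : ∀ i, u i s ≤ M) (i : Fin N) :
    u i (s + (N + 2) * B) ≤
      M + ((N + 2) * B : ℕ) * E - b ^ ((N + 2) * B) * (M - u j₀ s) := by
  have := h.forall_of_propagates hB
    (Q := fun t i => u i t ≤ M + (t - s : ℕ) * E - b ^ (t - s) * (M - u j₀ s)) (s := s)
    (j₀ := j₀) (by simp) ?_ i
  · simpa using this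
  intro t hst i j hj hle
  obtain ⟨n, rfl⟩ := Nat.exists_eq_add_of_le hst
  have e1 : s + n - s = n := by omega
  have e2 : s + n + 1 - s = n + 1 := by omega
  simp only [e1, e2] at hle ⊢
  have ht : 1 ≤ s + n := by omega
  have h1 := (abs_le.1 (hu (s + n) ht i)).2
  have h2 : A (s + n) i j * (M + n * E - u j (s + n)) ≤
      ∑ k, A (s + n) i k * (M + n * E - u k (s + n)) :=
    Finset.single_le_sum (f := fun k => A (s + n) i k * (M + n * E - u k (s + n)))
      (fun k _ => mul_nonneg (hA.nonneg _ ht i k)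
        (sub_nonneg.2 (hA.le_add hu hs hM n k))) (Finset.mem_univ j)
  simp only [mul_sub, Finset.sum_sub_distrib] at h2
  rw [← Finset.sum_mul, hA.row_sum _ ht i, one_mul, ← mul_sub] at h2
  have hD : 0 ≤ b ^ n * (M - u j₀ s) := mul_nonneg (by positivity) (sub_nonneg.2 (hM j₀))
  have h3 : b * (b ^ n * (M - u j₀ s)) ≤ A (s + n) i j * (M + n * E - u j (s + n)) :=
    mul_le_mul (hA.lower _ ht i j hj) (by linarith) hD (hA.nonneg _ ht i j)
  rw [pow_succ']
  push_cast
  linarith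

/-- The spread of a perturbed averaging recursion stays bounded by a multiple of the size of the
perturbations. -/
theorem IsAveraging.sub_le {b : ℝ} {A : ℕ → Matrix (Fin N) (Fin N) ℝ} (hA : net.IsAveraging b A)
    (h : net.Admissible a B) (hB : 0 < B) (hb : 0 < b) (hb' : b ≤ 1) {u : Fin N → ℕ → ℝ} {E : ℝ}
    (hu₁ : ∀ i, |u i 1| ≤ E)
    (hu : ∀ t, 1 ≤ t → ∀ i, |u i (t + 1) - ∑ j, A t i j * u j t| ≤ E)
    {t : ℕ} (ht : 1 ≤ t) (i j : Fin N) :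
    u i t - u j t ≤ spreadConst b ((N + 2) * B) * E := by
  have hu' : ∀ t, 1 ≤ t → ∀ i, |(-u i (t + 1)) - ∑ j, A t i j * (-u j t)| ≤ E := by
    intro t ht i
    have := hu t ht i
    rw [← abs_neg] at this
    convert this using 2
    simp only [mul_neg, Finset.sum_neg_distrib]
    ring
  have hE : 0 ≤ E := (abs_nonneg _).trans (hu₁ i)
  set L := (N + 2) * B with hL
  have hδ : 0 < b ^ L := by positivity
  have hδ' : b ^ L ≤ 1 := pow_le_one₀ hb.le hb'
  induction t using Nat.strong_induction_on generalizing i j with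
  | _ t ih =>
  rcases le_or_gt t L with hle | hgt
  · obtain ⟨n, rfl⟩ := Nat.exists_eq_add_of_le ht
    have h1 := hA.le_add hu le_rfl (M := E) (fun i => (abs_le.1 (hu₁ i)).2) n i
    have h2 := hA.le_add (u := fun i t => -u i t) hu' le_rfl (M := E)
      (fun i => by have := (abs_le.1 (hu₁ i)).1; linarith) n j
    have h3 : (n : ℝ) ≤ L := by exact_mod_cast (by omega : n ≤ L)
    have h4 : (n : ℝ) * E ≤ L * E := mul_le_mul_of_nonneg_right h3 hE
    have h5 : 0 ≤ 2 * (L : ℝ) / b ^ L * E := by positivity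
    rw [spreadConst]
    linarith
  · obtain ⟨s, rfl⟩ : ∃ s, t = s + L := ⟨t - L, by omega⟩
    have hs : 1 ≤ s := by omega
    have hLpos : 0 < L := by positivity
    have : Nonempty (Fin N) := ⟨i⟩
    obtain ⟨iM, hiM⟩ := Finite.exists_max fun i => u i s
    obtain ⟨im, him⟩ := Finite.exists_min fun i => u i s
    have h1 := hA.window h hB hb hu hs (j₀ := im) hiM i
    have h2 := hA.le_add (u := fun i t => -u i t) hu' hs (M := -u im s)
      (fun i => neg_le_neg (him i)) L j
    have h3 := ih s (by omega) hs iM im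
    have h4 : (1 - b ^ L) * (u iM s - u im s) ≤ (1 - b ^ L) * (spreadConst b L * E) :=
      mul_le_mul_of_nonneg_left h3 (by linarith)
    have h5 : 2 * L * E ≤ b ^ L * (spreadConst b L * E) := by
      have : b ^ L * spreadConst b L = 2 * L + b ^ L * (2 * (L + 1)) := by
        rw [spreadConst]; field_simp
      rw [← mul_assoc, this]
      exact mul_le_mul_of_nonneg_right (le_add_of_nonneg_right (by positivity)) hE
    rw [← hL] at h1
    linarith

/-- Vector version of `IsAveraging.sub_le`, obtained by testing against a fixed vector. -/
theorem IsAveraging.norm_sub_le {V : Type*} [NormedAddCommGroup V] [InnerProductSpace ℝ V]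
    {b : ℝ} {A : ℕ → Matrix (Fin N) (Fin N) ℝ} (hA : net.IsAveraging b A)
    (h : net.Admissible a B) (hB : 0 < B) (hb : 0 < b) (hb' : b ≤ 1) {u : Fin N → ℕ → V} {E : ℝ}
    (hu₁ : ∀ i, ‖u i 1‖ ≤ E)
    (hu : ∀ t, 1 ≤ t → ∀ i, ‖u i (t + 1) - ∑ j, A t i j • u j t‖ ≤ E)
    {t : ℕ} (ht : 1 ≤ t) (i j : Fin N) :
    ‖u i t - u j t‖ ≤ spreadConst b ((N + 2) * B) * E := by
  have hE : 0 ≤ E := (norm_nonneg _).trans (hu₁ i)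
  set v := u i t - u j t with hv
  have hinner : ∀ w : V, ‖w‖ ≤ E → |inner ℝ v w| ≤ ‖v‖ * E := fun w hw =>
    (abs_real_inner_le_norm v w).trans (mul_le_mul_of_nonneg_left hw (norm_nonneg v))
  have key := hA.sub_le h hB hb hb' (u := fun i t => inner ℝ v (u i t)) (E := ‖v‖ * E)
    (fun i => hinner _ (hu₁ i))
    (fun t ht i => by
      have := hinner _ (hu t ht i)
      simpa only [inner_sub_right, inner_sum, real_inner_smul_right] using this) ht i j
  rw [← inner_sub_right, ← hv, real_inner_self_eq_norm_sq] at key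
  rcases (norm_nonneg v).eq_or_lt with h0 | h0
  · rw [← h0]
    have : 0 ≤ spreadConst b ((N + 2) * B) := by unfold spreadConst; positivity
    positivity
  · refine le_of_mul_le_mul_left ?_ h0
    linarith [key, sq ‖v‖]

end Network

/-! ### Euclidean norms and the projection onto the nonnegative orthant -/

lemma Eucl.norm_le_norm {p : ℕ} {v w : Eucl p} (h : ∀ k, |v k| ≤ |w k|) : ‖v‖ ≤ ‖w‖ := by
  rw [EuclideanSpace.norm_eq, EuclideanSpace.norm_eq]
  refine Real.sqrt_le_sqrt (Finset.sum_le_sum fun k _ => ?_)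
  simpa using sq_le_sq.2 (h k)

@[simp] lemma nonnegProj_apply {p : ℕ} (v : Eucl p) (k : Fin p) :
    nonnegProj v k = max (v k) 0 := rfl

lemma norm_nonnegProj_le {p : ℕ} (v : Eucl p) : ‖nonnegProj v‖ ≤ ‖v‖ := by
  refine Eucl.norm_le_norm fun k => ?_
  rw [nonnegProj_apply, abs_of_nonneg (le_max_right _ _)]
  exact max_le (le_abs_self _) (abs_nonneg _)

lemma norm_nonnegProj_le_of_le {p : ℕ} {v w : Eucl p} (h : ∀ k, v k ≤ w k) (hw : ∀ k, 0 ≤ w k) :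
    ‖nonnegProj v‖ ≤ ‖w‖ := by
  refine Eucl.norm_le_norm fun k => ?_
  rw [nonnegProj_apply, abs_of_nonneg (le_max_right _ _), abs_of_nonneg (hw k)]
  exact max_le (h k) (hw k)

/-- The projection is nonexpansive and fixes `u ≥ 0`. -/
lemma norm_nonnegProj_add_sub_le {p : ℕ} {u : Eucl p} (hu : ∀ k, 0 ≤ u k) (v : Eucl p) :
    ‖nonnegProj (u + v) - u‖ ≤ ‖v‖ := by
  refine Eucl.norm_le_norm fun k => ?_
  have h := abs_max_sub_max_le_abs (u k + v k) (u k) 0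
  rw [max_eq_left (hu k), add_sub_cancel_left] at h
  simpa using h

/-- The Cauchy–Schwarz inequality for a vector sum whose terms satisfy `‖v j‖² ≤ f j * g j`. -/
lemma norm_sum_sq_le {V ι : Type*} [SeminormedAddCommGroup V] (s : Finset ι) (v : ι → V)
    {f g : ι → ℝ} (hf : ∀ j ∈ s, 0 ≤ f j) (hg : ∀ j ∈ s, 0 ≤ g j)
    (h : ∀ j ∈ s, ‖v j‖ ^ 2 ≤ f j * g j) :
    ‖∑ j ∈ s, v j‖ ^ 2 ≤ (∑ j ∈ s, f j) * ∑ j ∈ s, g j :=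
  (pow_le_pow_left₀ (norm_nonneg _) (norm_sum_le s v) 2).trans
    (Finset.sum_sq_le_sum_mul_sum_of_sq_le_mul s hf hg h)

/-- The three-point inequality for a proximal step: since `h + η ‖· - x₀‖²` is strongly convex,
its value at a point `z` exceeds the minimum by at least `η ‖z - x‖²`. -/
lemma IsMinOn.three_point {V : Type*} [NormedAddCommGroup V] [InnerProductSpace ℝ V] {X : Set V}
    {h : V → ℝ} (hh : ConvexOn ℝ X h) {η : ℝ} {x₀ x z : V}
    (hmin : IsMinOn (fun z => h z + η * ‖z - x₀‖ ^ 2) X x) (hx : x ∈ X) (hz : z ∈ X) :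
    h x + η * ‖x - x₀‖ ^ 2 + η * ‖z - x‖ ^ 2 ≤ h z + η * ‖z - x₀‖ ^ 2 := by
  have expand : ∀ θ : ℝ, ‖x + θ • (z - x) - x₀‖ ^ 2 =
      ‖x - x₀‖ ^ 2 + 2 * θ * inner ℝ (x - x₀) (z - x) + θ ^ 2 * ‖z - x‖ ^ 2 := by
    intro θ
    rw [show x + θ • (z - x) - x₀ = (x - x₀) + θ • (z - x) by abel, norm_add_sq_real,
      real_inner_smul_right, norm_smul, mul_pow, Real.norm_eq_abs, sq_abs]
    ring
  have hlim : 0 ≤ h z - h x + 2 * η * inner ℝ (x - x₀) (z - x) := by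
    have htend : Filter.Tendsto
        (fun θ : ℝ => h z - h x + 2 * η * inner ℝ (x - x₀) (z - x) + θ * (η * ‖z - x‖ ^ 2))
        (nhdsWithin 0 (Set.Ioi 0))
        (nhds (h z - h x + 2 * η * inner ℝ (x - x₀) (z - x) + 0 * (η * ‖z - x‖ ^ 2))) :=
      (Continuous.tendsto (by fun_prop) 0).mono_left nhdsWithin_le_nhds
    rw [zero_mul, add_zero] at htend
    refine ge_of_tendsto htend ?_
    filter_upwards [Ioc_mem_nhdsGT (zero_lt_one (α := ℝ))] with θ hθ
    have hcomb : x + θ • (z - x) = (1 - θ) • x + θ • z := by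
      rw [smul_sub, sub_smul, one_smul]; abel
    have h1 := hh.2 hx hz (sub_nonneg.2 hθ.2) hθ.1.le (by ring)
    have hmem := hh.1 hx hz (sub_nonneg.2 hθ.2) hθ.1.le (by ring)
    have h2 := isMinOn_iff.1 hmin _ hmem
    simp only [smul_eq_mul] at h1
    rw [← hcomb] at h1 h2
    simp only [expand] at h2
    refine nonneg_of_mul_nonneg_right ?_ hθ.1
    nlinarith
  have h1 := expand 1
  rw [one_smul, add_sub_cancel] at h1
  rw [h1]
  linarith

/-! ### Bounds along a run of the algorithm -/

namespace IsDUSTRun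

variable {N p B : ℕ} {a F G R : ℝ} {d : Fin N → ℕ} {net : Network N} {P : OnlineProblem N p d}
  {sub : ∀ i, ℕ → Eucl (d i) → Eucl (d i)} {α η : ℕ → ℝ} {it : DUSTIterates N p d}

lemma x_mem (hrun : IsDUSTRun net P sub α η it) {t : ℕ} (ht : 1 ≤ t) (i : Fin N) :
    it.x i t ∈ P.X i := by
  cases t, ht using Nat.le_induction with
  | base => exact hrun.x_one i
  | succ n hn => exact hrun.x_succ_mem n hn i

lemma c_succ_eq (hrun : IsDUSTRun net P sub α η it) (hnet : net.Admissible a B) (t : ℕ)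
    (ht : 1 ≤ t) (i : Fin N) : it.c i (t + 1) = ∑ j, net.W t i j * it.c j t :=
  (hrun.c_succ t ht i).trans (hnet.sum_inNeighbors_smul ht i fun j => it.c j t)

lemma sum_c (hrun : IsDUSTRun net P sub α η it) (hnet : net.Admissible a B) {t : ℕ}
    (ht : 1 ≤ t) : ∑ i, it.c i t = N :=
  hnet.sum_mass hrun.c_one (hrun.c_succ_eq hnet) ht

lemma c_ge (hrun : IsDUSTRun net P sub α η it) (hnet : net.Admissible a B) (hB : 0 < B)
    (ha : 0 < a) (ha' : a < 1) {t : ℕ} (ht : 1 ≤ t) (i : Fin N) :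
    a ^ ((N + 2) * B) ≤ it.c i t :=
  hnet.mass_ge hB ha ha' hrun.c_one (hrun.c_succ_eq hnet) ht i

lemma c_pos (hrun : IsDUSTRun net P sub α η it) (hnet : net.Admissible a B) (hB : 0 < B)
    (ha : 0 < a) (ha' : a < 1) {t : ℕ} (ht : 1 ≤ t) (i : Fin N) : 0 < it.c i t :=
  (pow_pos ha _).trans_le (hrun.c_ge hnet hB ha ha' ht i)

lemma c_le (hrun : IsDUSTRun net P sub α η it) (hnet : net.Admissible a B) (hB : 0 < B)
    (ha : 0 < a) (ha' : a < 1) {t : ℕ} (ht : 1 ≤ t) (i : Fin N) : it.c i t ≤ N := by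
  rw [← hrun.sum_c hnet ht]
  exact Finset.single_le_sum (f := fun i => it.c i t)
    (fun j _ => (hrun.c_pos hnet hB ha ha' ht j).le) (Finset.mem_univ i)

/-- Dividing by the masses `c_{i,t}` turns the column-stochastic mixing into a row-stochastic
averaging. -/
theorem isAveraging (hrun : IsDUSTRun net P sub α η it) (hnet : net.Admissible a B) (hB : 0 < B)
    (ha : 0 < a) (ha' : a < 1) :
    net.IsAveraging (a * a ^ ((N + 2) * B) / N)
      (fun t i j => net.W t i j * it.c j t / it.c i (t + 1)) where
  nonneg t ht i j := div_nonneg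
    (mul_nonneg (hnet.weight_nonneg ht i j) (hrun.c_pos hnet hB ha ha' ht j).le)
    (hrun.c_pos hnet hB ha ha' (by omega) i).le
  row_sum t ht i := by
    rw [← Finset.sum_div, ← hrun.c_succ_eq hnet t ht i]
    exact div_self (hrun.c_pos hnet hB ha ha' (by omega) i).ne'
  lower t ht i j hj := div_le_div₀
    (mul_nonneg (hnet.weight_nonneg ht i j) (hrun.c_pos hnet hB ha ha' ht j).le)
    (mul_le_mul (hnet.weight_ge ht hj) (hrun.c_ge hnet hB ha ha' ht j) (by positivity)
      (hnet.weight_nonneg ht i j))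
    (hrun.c_pos hnet hB ha ha' (by omega) i) (hrun.c_le hnet hB ha ha' (by omega) i)

lemma sum_averaging_smul (hrun : IsDUSTRun net P sub α η it) (hnet : net.Admissible a B)
    (hB : 0 < B) (ha : 0 < a) (ha' : a < 1) {t : ℕ} (ht : 1 ≤ t) (i : Fin N)
    (v : Fin N → Eucl p) :
    ∑ j, (net.W t i j * it.c j t / it.c i (t + 1)) • ((it.c j t)⁻¹ • v j) =
      (it.c i (t + 1))⁻¹ • ∑ j, net.W t i j • v j := by
  rw [Finset.smul_sum]
  refine Finset.sum_congr rfl fun j _ => ?_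
  have := (hrun.c_pos hnet hB ha ha' ht j).ne'
  rw [smul_smul, smul_smul]
  congr 1
  field_simp

lemma y_succ_eq (hrun : IsDUSTRun net P sub α η it) (hnet : net.Admissible a B) {t : ℕ}
    (ht : 1 ≤ t) (i : Fin N) : it.y i (t + 1) =
      ∑ j, net.W t i j • it.y j t + (P.g i (it.x i (t + 1)) - P.g i (it.x i t)) := by
  rw [hrun.y_succ t ht i, hnet.sum_inNeighbors_smul ht i, add_sub_assoc]

lemma lam_succ_eq (hrun : IsDUSTRun net P sub α η it) (hnet : net.Admissible a B) {t : ℕ}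
    (ht : 1 ≤ t) (i : Fin N) :
    it.lam i (t + 1) = (it.c i (t + 1))⁻¹ • ∑ j, net.W t i j • it.mu j t := by
  rw [hrun.lam_succ t ht i, hnet.sum_inNeighbors_smul ht i]

lemma mu_succ_eq (hrun : IsDUSTRun net P sub α η it) (hnet : net.Admissible a B) (hB : 0 < B)
    (ha : 0 < a) (ha' : a < 1) {t : ℕ} (ht : 1 ≤ t) (i : Fin N) : it.mu i (t + 1) =
      nonnegProj (it.c i (t + 1) • it.lam i (t + 1) + it.y i (t + 1)) := by
  rw [hrun.mu_succ t ht i, hnet.sum_inNeighbors_smul ht i, hrun.lam_succ_eq hnet ht,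
    smul_inv_smul₀ (hrun.c_pos hnet hB ha ha' (by omega) i).ne']

lemma mu_nonneg (hrun : IsDUSTRun net P sub α η it) {t : ℕ} (ht : 1 ≤ t) (i : Fin N)
    (k : Fin p) : 0 ≤ it.mu i t k := by
  cases t, ht using Nat.le_induction with
  | base => simp [hrun.mu_one i]
  | succ n hn => rw [hrun.mu_succ n hn i]; exact le_max_right _ _

lemma lam_nonneg (hrun : IsDUSTRun net P sub α η it) (hnet : net.Admissible a B) (hB : 0 < B)
    (ha : 0 < a) (ha' : a < 1) {t : ℕ} (ht : 1 ≤ t) (i : Fin N) (k : Fin p) :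
    0 ≤ it.lam i (t + 1) k := by
  rw [hrun.lam_succ_eq hnet ht]
  simp only [PiLp.smul_apply, WithLp.ofLp_sum, Finset.sum_apply, smul_eq_mul]
  exact mul_nonneg (inv_nonneg.2 (hrun.c_pos hnet hB ha ha' (by omega) i).le)
    (Finset.sum_nonneg fun j _ => mul_nonneg (hnet.weight_nonneg ht i j)
      (hrun.mu_nonneg ht j k))

/-- The tracking property: the `y_{i,t}` always sum to the current coupled constraint value. -/
lemma sum_y (hrun : IsDUSTRun net P sub α η it) (hnet : net.Admissible a B) {t : ℕ}
    (ht : 1 ≤ t) : ∑ i, it.y i t = ∑ i, P.g i (it.x i t) := by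
  induction t, ht using Nat.le_induction with
  | base => exact Finset.sum_congr rfl fun i _ => hrun.y_one i
  | succ n hn ih =>
    rw [Finset.sum_congr rfl fun i _ => hrun.y_succ_eq hnet hn i, Finset.sum_add_distrib,
      hnet.sum_sum_smul hn, Finset.sum_sub_distrib, ih]
    abel

variable (N B a) in
/-- The spread constant of the averaging `IsDUSTRun.isAveraging`. -/
noncomputable def mixConst : ℝ :=
  Network.spreadConst (a * a ^ ((N + 2) * B) / N) ((N + 2) * B)

lemma mixConst_nonneg (ha : 0 < a) : 0 ≤ mixConst N B a := by
  unfold mixConst Network.spreadConst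
  positivity

/-- Consensus for a perturbed averaging along the run. -/
lemma norm_sub_le (hrun : IsDUSTRun net P sub α η it) (hnet : net.Admissible a B)
    (hB : 0 < B) (ha : 0 < a) (ha' : a < 1) {u : Fin N → ℕ → Eucl p} {E : ℝ}
    (hu₁ : ∀ i, ‖u i 1‖ ≤ E)
    (hu : ∀ t, 1 ≤ t → ∀ i,
      ‖u i (t + 1) - ∑ j, (net.W t i j * it.c j t / it.c i (t + 1)) • u j t‖ ≤ E)
    {t : ℕ} (ht : 1 ≤ t) (i j : Fin N) : ‖u i t - u j t‖ ≤ mixConst N B a * E := by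
  have hN : (1 : ℝ) ≤ N := by exact_mod_cast i.pos
  refine (hrun.isAveraging hnet hB ha ha').norm_sub_le hnet hB (by positivity) ?_ hu₁ hu ht i j
  have : a * a ^ ((N + 2) * B) ≤ 1 := by
    rw [← pow_succ']
    exact pow_le_one₀ ha.le ha'.le
  exact div_le_one_of_le₀ (this.trans hN) (by positivity)

variable (N B a F) in
/-- A bound for the normalized trackers `y_{i,t} / c_{i,t}`. -/
noncomputable def trackerBound : ℝ := mixConst N B a * (2 * F / a ^ ((N + 2) * B)) + F

lemma trackerBound_nonneg (ha : 0 < a) (hF : 0 ≤ F) : 0 ≤ trackerBound N B a F := by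
  have := mixConst_nonneg (N := N) (B := B) ha
  unfold trackerBound
  positivity

/-- The normalized trackers stay bounded: their spread is bounded because the increments of `g_i`
are, and so is their average with weights `c_{i,t} / N`. -/
theorem norm_y_le (hrun : IsDUSTRun net P sub α η it) (hnet : net.Admissible a B)
    (hB : 0 < B) (ha : 0 < a) (ha' : a < 1) (hP : P.Bounded sub F G) {t : ℕ} (ht : 1 ≤ t)
    (i : Fin N) : ‖it.y i t‖ ≤ it.c i t * trackerBound N B a F := by
  have hN : (0 : ℝ) < N := by exact_mod_cast i.pos
  have hF : 0 ≤ F := (norm_nonneg _).trans (hP.norm_g_le i _ (hrun.x_one i))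
  set κ := a ^ ((N + 2) * B) with hκ
  have hκ0 : 0 < κ := by positivity
  have hκ1 : κ ≤ 1 := pow_le_one₀ ha.le ha'.le
  have spread := fun i j => hrun.norm_sub_le hnet hB ha ha'
    (u := fun i t => (it.c i t)⁻¹ • it.y i t) (E := 2 * F / κ)
    (fun i => by
      simp only [hrun.c_one, hrun.y_one, inv_one, one_smul]
      refine (hP.norm_g_le i _ (hrun.x_one i)).trans ?_
      rw [le_div_iff₀ hκ0]
      nlinarith)
    (fun t ht i => by
      rw [hrun.sum_averaging_smul hnet hB ha ha' ht, hrun.y_succ_eq hnet ht, smul_add,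
        add_sub_cancel_left, norm_smul, norm_inv, Real.norm_eq_abs,
        abs_of_pos (hrun.c_pos hnet hB ha ha' (by omega) i), inv_mul_eq_div]
      refine div_le_div₀ (by positivity) ?_ hκ0 (hrun.c_ge hnet hB ha ha' (by omega) i)
      refine (_root_.norm_sub_le _ _).trans ?_
      have h1 := hP.norm_g_le i _ (hrun.x_mem ht i)
      have h2 := hP.norm_g_le i _ (hrun.x_mem (t := t + 1) (by omega) i)
      linarith) ht i j
  have hc := fun j => hrun.c_pos hnet hB ha ha' ht j
  set K := mixConst N B a * (2 * F / κ) with hK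
  have hsum : (N : ℝ) • ((it.c i t)⁻¹ • it.y i t) =
      ∑ j, it.c j t • ((it.c i t)⁻¹ • it.y i t - (it.c j t)⁻¹ • it.y j t) +
        ∑ j, P.g j (it.x j t) := by
    simp only [smul_sub, Finset.sum_sub_distrib, ← Finset.sum_smul, hrun.sum_c hnet ht]
    rw [Finset.sum_congr rfl fun j _ => smul_inv_smul₀ (hc j).ne' (it.y j t), hrun.sum_y hnet ht]
    abel
  have h1 : ‖∑ j, it.c j t • ((it.c i t)⁻¹ • it.y i t - (it.c j t)⁻¹ • it.y j t)‖ ≤ N * K := by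
    refine (norm_sum_le _ _).trans ?_
    rw [← hrun.sum_c hnet ht, Finset.sum_mul]
    refine Finset.sum_le_sum fun j _ => ?_
    rw [norm_smul, Real.norm_eq_abs, abs_of_pos (hc j)]
    exact mul_le_mul_of_nonneg_left (spread i j) (hc j).le
  have h2 : ‖∑ j, P.g j (it.x j t)‖ ≤ N * F := by
    refine (norm_sum_le_of_le _ fun j _ => hP.norm_g_le j _ (hrun.x_mem ht j)).trans ?_
    simp
  have h3 : (N : ℝ) * ‖(it.c i t)⁻¹ • it.y i t‖ ≤ N * (K + F) := by
    rw [← abs_of_pos hN, ← Real.norm_eq_abs, ← norm_smul, hsum, Real.norm_eq_abs, abs_of_pos hN]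
    refine (norm_add_le _ _).trans ?_
    linarith
  have h4 := le_of_mul_le_mul_left h3 hN
  rwa [norm_smul, norm_inv, Real.norm_eq_abs, abs_of_pos (hc i), inv_mul_le_iff₀ (hc i)] at h4

variable (N B a F) in
/-- A bound for the distance between the dual estimates `λ_{i,t}` of two nodes. -/
noncomputable def disagreement : ℝ := (mixConst N B a + 2) * trackerBound N B a F

lemma disagreement_nonneg (ha : 0 < a) (hF : 0 ≤ F) : 0 ≤ disagreement N B a F := by
  have := mixConst_nonneg (N := N) (B := B) ha
  have := trackerBound_nonneg (N := N) (B := B) ha hF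
  unfold disagreement
  positivity

/-- The nodes agree on the dual variable up to a constant, although the dual variable itself may
grow: `μ_{i,t} / c_{i,t}` is an averaging perturbed by at most `‖y_{i,t}‖ / c_{i,t}`. -/
theorem norm_lam_sub_le (hrun : IsDUSTRun net P sub α η it) (hnet : net.Admissible a B)
    (hB : 0 < B) (ha : 0 < a) (ha' : a < 1) (hP : P.Bounded sub F G) {t : ℕ} (ht : 1 ≤ t)
    (i j : Fin N) : ‖it.lam i (t + 1) - it.lam j (t + 1)‖ ≤ disagreement N B a F := by
  have hF : 0 ≤ F := (norm_nonneg _).trans (hP.norm_g_le i _ (hrun.x_one i))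
  set U := trackerBound N B a F with hU
  have hU0 : 0 ≤ U := trackerBound_nonneg ha hF
  have near : ∀ t, 1 ≤ t → ∀ i,
      ‖(it.c i (t + 1))⁻¹ • it.mu i (t + 1) - it.lam i (t + 1)‖ ≤ U := by
    intro t ht i
    have hc := hrun.c_pos hnet hB ha ha' (t := t + 1) (by omega) i
    have h1 : (it.c i (t + 1))⁻¹ • it.mu i (t + 1) - it.lam i (t + 1) = (it.c i (t + 1))⁻¹ •
        (nonnegProj (it.c i (t + 1) • it.lam i (t + 1) + it.y i (t + 1)) -
          it.c i (t + 1) • it.lam i (t + 1)) := by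
      rw [hrun.mu_succ_eq hnet hB ha ha' ht, smul_sub, inv_smul_smul₀ hc.ne']
    rw [h1, norm_smul, norm_inv, Real.norm_eq_abs, abs_of_pos hc, inv_mul_le_iff₀ hc]
    refine (norm_nonnegProj_add_sub_le (fun k => ?_) _).trans
      (hrun.norm_y_le hnet hB ha ha' hP (by omega) i)
    exact mul_nonneg hc.le (hrun.lam_nonneg hnet hB ha ha' ht i k)
  have spread := hrun.norm_sub_le hnet hB ha ha' (u := fun i t => (it.c i t)⁻¹ • it.mu i t)
    (E := U) (fun i => by simpa [hrun.mu_one] using hU0)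
    (fun t ht i => by
      rw [hrun.sum_averaging_smul hnet hB ha ha' ht, ← hrun.lam_succ_eq hnet ht]
      exact near t ht i) (t := t + 1) (by omega) i j
  have hi := near t ht i
  have hj := near t ht j
  rw [norm_sub_rev] at hi
  have htri := (norm_sub_le_norm_sub_add_norm_sub (it.lam i (t + 1))
    ((it.c i (t + 1))⁻¹ • it.mu i (t + 1)) (it.lam j (t + 1))).trans
    (add_le_add hi (norm_sub_le_norm_sub_add_norm_sub _
      ((it.c j (t + 1))⁻¹ • it.mu j (t + 1)) _))
  rw [disagreement]
  linarith

/-! ### The dual energy -/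

/-- The dual energy `∑ᵢ ‖μ_{i,t}‖² / c_{i,t}`. -/
noncomputable def energy (it : DUSTIterates N p d) (t : ℕ) : ℝ :=
  ∑ i, ‖it.mu i t‖ ^ 2 / it.c i t

lemma norm_sum_mu_sq_le (hrun : IsDUSTRun net P sub α η it) (hnet : net.Admissible a B)
    (hB : 0 < B) (ha : 0 < a) (ha' : a < 1) {t : ℕ} (ht : 1 ≤ t) :
    ‖∑ i, it.mu i t‖ ^ 2 ≤ N * energy it t := by
  have hc := fun j => hrun.c_pos hnet hB ha ha' ht j
  rw [← hrun.sum_c hnet ht]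
  exact norm_sum_sq_le _ _ (fun j _ => (hc j).le)
    (fun j _ => div_nonneg (sq_nonneg _) (hc j).le)
    (fun j _ => (mul_div_cancel₀ _ (hc j).ne').ge)

/-- Mixing does not increase the dual energy, by Cauchy–Schwarz and column stochasticity. -/
lemma sum_c_mul_norm_lam_sq_le (hrun : IsDUSTRun net P sub α η it) (hnet : net.Admissible a B)
    (hB : 0 < B) (ha : 0 < a) (ha' : a < 1) {t : ℕ} (ht : 1 ≤ t) :
    ∑ i, it.c i (t + 1) * ‖it.lam i (t + 1)‖ ^ 2 ≤ energy it t := by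
  have hc := fun j => hrun.c_pos hnet hB ha ha' ht j
  refine le_trans (Finset.sum_le_sum fun i _ => ?_)
    (hnet.sum_sum_smul ht fun j => ‖it.mu j t‖ ^ 2 / it.c j t).le
  have hci := hrun.c_pos hnet hB ha ha' (t := t + 1) (by omega) i
  have hcs := norm_sum_sq_le Finset.univ (fun j => net.W t i j • it.mu j t)
    (f := fun j => net.W t i j * it.c j t)
    (g := fun j => net.W t i j • (‖it.mu j t‖ ^ 2 / it.c j t))
    (fun j _ => mul_nonneg (hnet.weight_nonneg ht i j) (hc j).le)
    (fun j _ => mul_nonneg (hnet.weight_nonneg ht i j) (div_nonneg (sq_nonneg _) (hc j).le))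
    (fun j _ => by
      have := (hc j).ne'
      rw [norm_smul, mul_pow, Real.norm_eq_abs, sq_abs, smul_eq_mul]
      refine le_of_eq ?_
      field_simp)
  rw [← hrun.c_succ_eq hnet t ht i] at hcs
  rw [hrun.lam_succ_eq hnet ht, norm_smul, mul_pow, norm_inv, Real.norm_eq_abs, abs_of_pos hci]
  refine le_of_mul_le_mul_left (le_trans (le_of_eq ?_) hcs) hci
  have := hci.ne'
  field_simp

lemma energy_succ_le (hrun : IsDUSTRun net P sub α η it) (hnet : net.Admissible a B)
    (hB : 0 < B) (ha : 0 < a) (ha' : a < 1) (hP : P.Bounded sub F G) {t : ℕ} (ht : 1 ≤ t) :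
    energy it (t + 1) ≤ energy it t + 2 * ∑ i, inner ℝ (it.lam i (t + 1)) (it.y i (t + 1)) +
      N * trackerBound N B a F ^ 2 := by
  have ht' : 1 ≤ t + 1 := by omega
  have hc := fun j => hrun.c_pos hnet hB ha ha' ht' j
  have hterm : ∀ i, ‖it.mu i (t + 1)‖ ^ 2 / it.c i (t + 1) ≤
      it.c i (t + 1) * ‖it.lam i (t + 1)‖ ^ 2 +
        2 * inner ℝ (it.lam i (t + 1)) (it.y i (t + 1)) +
        it.c i (t + 1) * trackerBound N B a F ^ 2 := by
    intro i
    rw [div_le_iff₀ (hc i), hrun.mu_succ_eq hnet hB ha ha' ht]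
    refine (pow_le_pow_left₀ (norm_nonneg _) (norm_nonnegProj_le _) 2).trans ?_
    rw [norm_add_sq_real, norm_smul, real_inner_smul_left, Real.norm_eq_abs, mul_pow, sq_abs]
    have := pow_le_pow_left₀ (norm_nonneg _) (hrun.norm_y_le hnet hB ha ha' hP ht' i) 2
    linarith
  have hsum := Finset.sum_le_sum fun i (_ : i ∈ Finset.univ) => hterm i
  rw [Finset.sum_add_distrib, Finset.sum_add_distrib, ← Finset.sum_mul, hrun.sum_c hnet ht',
    ← Finset.mul_sum] at hsum
  have := hrun.sum_c_mul_norm_lam_sq_le hnet hB ha ha' ht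
  rw [energy]
  linarith

lemma convexOn_inner_g (hadm : P.Admissible R) (i : Fin N) {l : Eucl p} (hl : ∀ k, 0 ≤ l k) :
    ConvexOn ℝ (P.X i) fun z => inner ℝ l (P.g i z) := by
  refine ⟨hadm.convex i, fun x hx y hy s t hs ht hst => ?_⟩
  simp only [PiLp.inner_apply, smul_eq_mul, Finset.mul_sum, ← Finset.sum_add_distrib]
  refine Finset.sum_le_sum fun k _ => ?_
  have := mul_le_mul_of_nonneg_right ((hadm.convex_g i k).2 hx hy hs ht hst) (hl k)
  simp only [smul_eq_mul] at this
  simp only [RCLike.inner_apply, conj_trivial]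
  linarith

/-- One primal step compared with a point `z ∈ X_i`. -/
lemma inner_lam_g_le (hrun : IsDUSTRun net P sub α η it) (hnet : net.Admissible a B)
    (hB : 0 < B) (ha : 0 < a) (ha' : a < 1) (hadm : P.Admissible R) (hP : P.Bounded sub F G)
    {t : ℕ} (ht : 1 ≤ t) (hα : 0 ≤ α t) (hη : 0 ≤ η t) (i : Fin N) {z : Eucl (d i)}
    (hz : z ∈ P.X i) :
    inner ℝ (it.lam i (t + 1)) (P.g i (it.x i (t + 1))) ≤
      inner ℝ (it.lam i (t + 1)) (P.g i z) + α t * (G * R) +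
        η t * (‖z - it.x i t‖ ^ 2 - ‖z - it.x i (t + 1)‖ ^ 2) := by
  have hx := hrun.x_succ_mem t ht i
  set s := sub i t (it.x i t) with hs
  have hlin : ConvexOn ℝ (P.X i) fun z => α t * inner ℝ s (z - it.x i t) := by
    refine ⟨hadm.convex i, fun x _ y _ b c _ _ hbc => le_of_eq ?_⟩
    obtain rfl : c = 1 - b := by linarith
    simp only [inner_sub_right, inner_add_right, real_inner_smul_right, smul_eq_mul]
    ring
  have h3 := (hrun.x_succ_isMinOn t ht i).three_point
    (hlin.add (convexOn_inner_g hadm i (hrun.lam_nonneg hnet hB ha ha' ht i))) hx hz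
  simp only [Pi.add_apply] at h3
  have hcs : inner ℝ s (z - it.x i (t + 1)) ≤ G * R := by
    refine (real_inner_le_norm _ _).trans ?_
    have hsG := hP.norm_sub_le i t ht _ (hrun.x_mem ht i)
    refine mul_le_mul hsG ?_ (norm_nonneg _) ((norm_nonneg _).trans hsG)
    rw [← dist_eq_norm]
    exact (Metric.dist_le_diam_of_mem (hadm.compact i).isBounded hz hx).trans (hadm.diam_le i)
  have hcs' := mul_le_mul_of_nonneg_left hcs hα
  have hsplit : inner ℝ s (z - it.x i (t + 1)) =
      inner ℝ s (z - it.x i t) - inner ℝ s (it.x i (t + 1) - it.x i t) := by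
    rw [← inner_sub_right]; congr 1; abel
  rw [hsplit] at hcs'
  have := mul_nonneg hη (sq_nonneg ‖it.x i (t + 1) - it.x i t‖)
  linarith

/-- Replacing the local dual estimates by the one of a single node costs a constant. -/
lemma abs_sum_inner_lam_sub_le (hrun : IsDUSTRun net P sub α η it) (hnet : net.Admissible a B)
    (hB : 0 < B) (ha : 0 < a) (ha' : a < 1) (hP : P.Bounded sub F G) {t : ℕ} (ht : 1 ≤ t)
    (i₀ : Fin N) {v : Fin N → Eucl p} {m : Fin N → ℝ} (hv : ∀ i, ‖v i‖ ≤ m i) :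
    |∑ i, inner ℝ (it.lam i (t + 1)) (v i) - inner ℝ (it.lam i₀ (t + 1)) (∑ i, v i)| ≤
      disagreement N B a F * ∑ i, m i := by
  rw [inner_sum, ← Finset.sum_sub_distrib, Finset.mul_sum]
  refine (Finset.abs_sum_le_sum_abs _ _).trans (Finset.sum_le_sum fun i _ => ?_)
  rw [← inner_sub_left]
  have h := hrun.norm_lam_sub_le hnet hB ha ha' hP ht i i₀
  exact (abs_real_inner_le_norm _ _).trans
    (mul_le_mul h (hv i) (norm_nonneg _) ((norm_nonneg _).trans h))

/-- Comparing the primal step with a feasible point `z` bounds the growth of the energy by a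
telescoping term and a term proportional to the step size `α_t`. -/
lemma sum_inner_lam_y_le (hrun : IsDUSTRun net P sub α η it) (hnet : net.Admissible a B)
    (hB : 0 < B) (ha : 0 < a) (ha' : a < 1) (hadm : P.Admissible R) (hP : P.Bounded sub F G)
    {t : ℕ} (ht : 1 ≤ t) (hα : 0 ≤ α t) (hη : 0 ≤ η t) (i₀ : Fin N) {z : ∀ i, Eucl (d i)}
    (hz : z ∈ P.feasibleSet) :
    ∑ i, inner ℝ (it.lam i (t + 1)) (it.y i (t + 1)) ≤
      disagreement N B a F * (N * trackerBound N B a F) + 2 * (disagreement N B a F * (N * F)) +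
        N * (α t * (G * R)) +
        η t * (∑ i, ‖z i - it.x i t‖ ^ 2 - ∑ i, ‖z i - it.x i (t + 1)‖ ^ 2) := by
  have ht' : 1 ≤ t + 1 := by omega
  have hconst : ∑ _i : Fin N, F = N * F := by simp
  have h1 := (abs_le.1 (hrun.abs_sum_inner_lam_sub_le hnet hB ha ha' hP ht i₀
    (fun i => hrun.norm_y_le hnet hB ha ha' hP ht' i))).2
  have h2 := (abs_le.1 (hrun.abs_sum_inner_lam_sub_le hnet hB ha ha' hP ht i₀
    (fun i => hP.norm_g_le i _ (hrun.x_mem ht' i)))).1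
  have h3 := (abs_le.1 (hrun.abs_sum_inner_lam_sub_le hnet hB ha ha' hP ht i₀
    (fun i => hP.norm_g_le i _ (hz.1 i)))).2
  rw [← Finset.sum_mul, hrun.sum_c hnet ht', hrun.sum_y hnet ht'] at h1
  rw [hconst] at h2 h3
  have h4 : inner ℝ (it.lam i₀ (t + 1)) (∑ i, P.g i (z i)) ≤ 0 := by
    rw [PiLp.inner_apply]
    refine Finset.sum_nonpos fun k _ => ?_
    simp only [RCLike.inner_apply, conj_trivial]
    exact mul_nonpos_of_nonpos_of_nonneg (hz.2 k) (hrun.lam_nonneg hnet hB ha ha' ht i₀ k)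
  have h5 := Finset.sum_le_sum fun i (_ : i ∈ Finset.univ) =>
    hrun.inner_lam_g_le hnet hB ha ha' hadm hP ht hα hη i (hz.1 i)
  rw [Finset.sum_add_distrib, Finset.sum_add_distrib, Finset.sum_const, Finset.card_univ,
    Fintype.card_fin, nsmul_eq_mul, ← Finset.mul_sum, Finset.sum_sub_distrib] at h5
  linarith

/-- The total dual variable dominates the accumulated constraint values, the first one
excepted. -/
lemma sum_sum_g_apply_le (hrun : IsDUSTRun net P sub α η it) (hnet : net.Admissible a B)
    {T : ℕ} (hT : 1 ≤ T) (k : Fin p) :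
    (∑ t ∈ Finset.Icc 1 T, ∑ i, P.g i (it.x i t)) k ≤
      (∑ i, it.mu i T) k + (∑ i, P.g i (it.x i 1)) k := by
  induction T, hT using Nat.le_induction with
  | base => simp [hrun.mu_one]
  | succ n hn ih =>
    rw [Finset.sum_Icc_succ_top (by omega), PiLp.add_apply]
    have hmu : (∑ i, it.mu i n) k + (∑ i, P.g i (it.x i (n + 1))) k ≤
        (∑ i, it.mu i (n + 1)) k := by
      rw [← hrun.sum_y hnet (t := n + 1) (by omega), ← PiLp.add_apply, ← hnet.sum_sum_smul hn,
        ← Finset.sum_add_distrib]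
      simp only [WithLp.ofLp_sum, Finset.sum_apply]
      refine Finset.sum_le_sum fun i _ => ?_
      rw [hrun.mu_succ n hn i, hnet.sum_inNeighbors_smul hn i]
      exact le_max_left _ _
    linarith

variable (N B a F G R) in
/-- The constant in the bound `energy ≤ energyConst * T ^ (3 / 2)`. -/
noncomputable def energyConst : ℝ :=
  2 * (disagreement N B a F * (N * trackerBound N B a F)) + 4 * (disagreement N B a F * (N * F)) +
    2 * (N * (G * R)) + N * trackerBound N B a F ^ 2 + 2 * (N * R ^ 2)

/-- With `α_t = √t` and `η_t = t` the dual energy grows at most like `t ^ (3 / 2)`. The weight `t`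
of the distance to the comparison point is part of the potential, so that increasing it to `t + 1`
costs a bounded amount only. -/
theorem energy_le (hrun : IsDUSTRun net P sub (fun t => √(t : ℝ)) (fun t => (t : ℝ)) it)
    (hnet : net.Admissible a B) (hB : 0 < B) (ha : 0 < a) (ha' : a < 1) (hadm : P.Admissible R)
    (hP : P.Bounded sub F G) (hne : P.feasibleSet.Nonempty) (i₀ : Fin N) {T : ℕ} (hT : 1 ≤ T) :
    energy it T ≤ energyConst N B a F G R * (T * √T) := by
  obtain ⟨z, hz⟩ := hne
  have hF : 0 ≤ F := (norm_nonneg _).trans (hP.norm_g_le i₀ _ (hrun.x_one i₀))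
  have hG : 0 ≤ G := (norm_nonneg _).trans (hP.norm_sub_le i₀ 1 le_rfl _ (hrun.x_one i₀))
  have hR : 0 ≤ R := Metric.diam_nonneg.trans (hadm.diam_le i₀)
  have hD := disagreement_nonneg (N := N) (B := B) ha hF
  have hU := trackerBound_nonneg (N := N) (B := B) ha hF
  set r : ℕ → ℝ := fun t => ∑ i, ‖z i - it.x i t‖ ^ 2 with hr
  have hr0 : ∀ t, 0 ≤ r t := fun t => Finset.sum_nonneg fun i _ => sq_nonneg _
  have hrR : ∀ t, 1 ≤ t → r t ≤ N * R ^ 2 := by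
    intro t ht
    have : ∀ i ∈ Finset.univ, ‖z i - it.x i t‖ ^ 2 ≤ R ^ 2 := fun i _ => by
      rw [← dist_eq_norm]
      exact pow_le_pow_left₀ dist_nonneg ((Metric.dist_le_diam_of_mem (hadm.compact i).isBounded
        (hz.1 i) (hrun.x_mem ht i)).trans (hadm.diam_le i)) 2
    simpa using Finset.sum_le_sum this
  set K := energyConst N B a F G R with hK
  have hK0 : 0 ≤ K := by rw [hK, energyConst]; positivity
  suffices hpot : energy it T + 2 * (T * r T) ≤ K * (T * √T) by
    have : 0 ≤ (T : ℝ) * r T := mul_nonneg (Nat.cast_nonneg _) (hr0 T)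
    linarith
  induction T, hT using Nat.le_induction with
  | base =>
    have h1 : 2 * (N * R ^ 2) ≤ K := by
      rw [hK, energyConst]
      exact le_add_of_nonneg_left (by positivity)
    have h2 : energy it 1 = 0 := by simp [energy, hrun.mu_one]
    have h3 := hrR 1 le_rfl
    simp only [h2, Nat.cast_one, Real.sqrt_one]
    linarith
  | succ t ht ih =>
    have hsq : 1 ≤ √(t : ℝ) := Real.one_le_sqrt.2 (by exact_mod_cast ht)
    have h1 := hrun.energy_succ_le hnet hB ha ha' hP ht
    have h2 := hrun.sum_inner_lam_y_le hnet hB ha ha' hadm hP ht (Real.sqrt_nonneg _)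
      (Nat.cast_nonneg _) i₀ hz
    change _ ≤ _ + (t : ℝ) * (r t - r (t + 1)) at h2
    have h3 := hrR (t + 1) (by omega)
    -- every bounded term is absorbed into `K √t` because `1 ≤ √t`
    have h4 : 2 * (disagreement N B a F * (N * trackerBound N B a F)) +
        4 * (disagreement N B a F * (N * F)) + 2 * (N * (√t * (G * R))) +
        N * trackerBound N B a F ^ 2 + 2 * (N * R ^ 2) ≤ K * √t := by
      have h5 : 0 ≤ (2 * (disagreement N B a F * (N * trackerBound N B a F)) +
        4 * (disagreement N B a F * (N * F)) +
        N * trackerBound N B a F ^ 2 + 2 * (N * R ^ 2)) * (√t - 1) :=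
        mul_nonneg (by positivity) (sub_nonneg.2 hsq)
      rw [hK, energyConst]
      linarith
    have h6 : K * (((t : ℝ) + 1) * √t) ≤ K * (((t : ℝ) + 1) * √((t : ℝ) + 1)) := by
      refine mul_le_mul_of_nonneg_left (mul_le_mul_of_nonneg_left ?_ (by positivity)) hK0
      exact Real.sqrt_le_sqrt (by linarith)
    push_cast
    linarith

end IsDUSTRun

/-! ### The cumulative constraint violation -/

theorem theorem2 (N p B : ℕ) (hB : 0 < B) (a F G R : ℝ) (ha : 0 < a) (ha' : a < 1) :
    ∃ C : ℝ, ∀ (d : Fin N → ℕ) (net : Network N) (P : OnlineProblem N p d)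
      (sub : ∀ i, ℕ → Eucl (d i) → Eucl (d i)) (it : DUSTIterates N p d),
      net.Admissible a B →
      P.Admissible R →
      P.feasibleSet.Nonempty →
      P.IsSubgradientSelection sub →
      P.Bounded sub F G →
      IsDUSTRun net P sub (fun t => Real.sqrt (t : ℝ)) (fun t => (t : ℝ)) it →
      ∀ T : ℕ, 1 ≤ T →
        P.cumulativeViolation it.x T ≤ C * (T : ℝ) ^ (3 / 4 : ℝ) := by
  refine ⟨√(N * IsDUSTRun.energyConst N B a F G R) + N * |F|, ?_⟩
  intro d net P sub it hnet hadm hne _ hP hrun T hT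
  have hT1 : (1 : ℝ) ≤ T := by exact_mod_cast hT
  have hmu : ‖∑ i, it.mu i T‖ ≤
      √(N * IsDUSTRun.energyConst N B a F G R) * (T : ℝ) ^ (3 / 4 : ℝ) := by
    rcases Nat.eq_zero_or_pos N with rfl | hN
    · simp
    have h1 := hrun.norm_sum_mu_sq_le hnet hB ha ha' hT
    have h2 := hrun.energy_le hnet hB ha ha' hadm hP hne ⟨0, hN⟩ hT
    have hpow : (T : ℝ) * √T = ((T : ℝ) ^ (3 / 4 : ℝ)) ^ 2 := by
      rw [Real.sqrt_eq_rpow, ← Real.rpow_natCast, ← Real.rpow_mul (by positivity)]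
      nth_rewrite 1 [← Real.rpow_one (T : ℝ)]
      rw [← Real.rpow_add (by positivity)]
      norm_num
    rw [hpow] at h2
    have h3 : ‖∑ i, it.mu i T‖ ^ 2 ≤
        (N * IsDUSTRun.energyConst N B a F G R) * ((T : ℝ) ^ (3 / 4 : ℝ)) ^ 2 :=
      h1.trans ((mul_le_mul_of_nonneg_left h2 (Nat.cast_nonneg N)).trans_eq (mul_assoc _ _ _).symm)
    have h4 := Real.le_sqrt_of_sq_le h3
    rwa [Real.sqrt_mul' _ (sq_nonneg _), Real.sqrt_sq (by positivity)] at h4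
  have hg : ‖∑ i, P.g i (it.x i 1)‖ ≤ N * |F| * (T : ℝ) ^ (3 / 4 : ℝ) := by
    have h1 : ‖∑ i, P.g i (it.x i 1)‖ ≤ ∑ _i : Fin N, |F| :=
      norm_sum_le_of_le _ fun i _ =>
        (hP.norm_g_le i _ (hrun.x_one i)).trans (le_abs_self F)
    rw [Finset.sum_const, Finset.card_univ, Fintype.card_fin, nsmul_eq_mul] at h1
    exact h1.trans (le_mul_of_one_le_right (by positivity)
      (Real.one_le_rpow hT1 (by norm_num)))
  have hmu0 : ∀ k, 0 ≤ (∑ i, it.mu i T) k := fun k => by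
    simp only [WithLp.ofLp_sum, Finset.sum_apply]
    exact Finset.sum_nonneg fun i _ => hrun.mu_nonneg hT i k
  have hviol : P.cumulativeViolation it.x T ≤
      ‖∑ i, it.mu i T + nonnegProj (∑ i, P.g i (it.x i 1))‖ :=
    norm_nonnegProj_le_of_le
      (fun k => (hrun.sum_sum_g_apply_le hnet hT k).trans
        (add_le_add_right (le_max_left _ _) _))
      (fun k => add_nonneg (hmu0 k) (le_max_right _ _))
  calc P.cumulativeViolation it.x T
      ≤ ‖∑ i, it.mu i T‖ + ‖nonnegProj (∑ i, P.g i (it.x i 1))‖ := hviol.trans (norm_add_le _ _)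
    _ ≤ _ := by
      rw [add_mul]
      exact add_le_add hmu ((norm_nonnegProj_le _).trans hg)
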